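/- Let $p$ be a prime, $\mathbb{K}$ a field of characteristic $p$, $R=\mathbb{K}[[x,y,z]]$, $I=(xy,yz)\subseteq R$, $S=R/I$ (a local ring), and let $E_S$ be an injective hull of the residue field of $S$. For an $S$-module $M$ and $e\ge 0$ let $\mathcal{F}^e(M)$ be the group of additive maps $\phi:M\to M$ with $\phi(sm)=s^{p^e}\phi(m)$ for all $s\in S$, $m\in M$, and let $\mathcal{F}(M)=\bigoplus_{e\ge 0}\mathcal{F}^e(M)$ be the ring (in general non-commutative) whose multiplication is given by composition of homogeneous elements; it contains $\mathcal{F}^0(M)=\mathrm{Hom}_S(M,M)$ as a subring. For an ideal $J$ of $R$ let $J^{[q]}$ denote the ideal generated by the $q$-th powers of the elements of $J$, and put, for $e\ge 0$, $K_e=(I^{[p^e]}:I)$ and $$L_e=\sum_{\substack{1\le\beta_1,\dots,\beta_s<e\\ \beta_1+\dots+\beta_s=e}}K_{\beta_1}K_{\beta_2}^{[p^{\beta_1}]}K_{\beta_3}^{[p^{\beta_1+\beta_2}]}\cdots K_{\beta_s}^{[p^{\beta_1+\dots+\beta_{s-1}}]}.$$ Then: 1. the natural map $S\to\mathrm{Hom}_S(E_S,E_S)$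 is an isomorphism; 2. $\mathcal{F}(E_S)$ is not finitely generated as an algebra over $\mathrm{Hom}_S(E_S,E_S)=S$, i.e. there is no finite set $T\subseteq\mathcal{F}(E_S)$ such that $\mathcal{F}(E_S)$ is generated as a ring by $\mathcal{F}^0(E_S)\cup T$; 3. for every $e\ge 1$, $K_e$ is generated by $x^{p^e}y^{p^e-1}$, $x^{p^e-1}y^{p^e-1}z^{p^e-1}$ and $y^{p^e-1}z^{p^e}$, and the generator $x^{p^e}y^{p^e-1}$ does not lie in $L_e$. -/

import Mathlib

open scoped DirectSum

universe u v

namespace FrobeniusMaps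

section FrobeniusAlgebra

/-- `frobeniusMaps p S M e` is the group `𝓕^e(M)` of all additive maps `φ : M → M` such that
`φ (s m) = s ^ (p ^ e) φ m` for all `s ∈ S` and `m ∈ M`. -/
def frobeniusMaps (p : ℕ) (S : Type u) [CommRing S] (M : Type v) [AddCommGroup M] [Module S M]
    (e : ℕ) : AddSubgroup (AddMonoid.End M) where
  carrier := {φ | ∀ (s : S) (m : M), φ (s • m) = s ^ (p ^ e) • φ m}
  zero_mem' := fun s m => (smul_zero (s ^ (p ^ e))).symm
  add_mem' := fun {φ ψ} hφ hψ s m => by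
    have h1 := hφ s m
    have h2 := hψ s m
    change φ (s • m) + ψ (s • m) = s ^ (p ^ e) • (φ m + ψ m)
    rw [h1, h2, smul_add]
  neg_mem' := fun {φ} hφ s m => by
    have h1 := hφ s m
    change -φ (s • m) = s ^ (p ^ e) • -φ m
    rw [h1, smul_neg]

variable (p : ℕ) (S : Type u) [CommRing S] (M : Type v) [AddCommGroup M] [Module S M]

/-- The identity has degree `0`, and degrees add under composition. -/
instance frobeniusMaps_gradedMonoid : SetLike.GradedMonoid (frobeniusMaps p S M) where
  one_mem := fun s m => by simp
  mul_mem := fun i j φ ψ hφ hψ s m => by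
    have h1 : ψ (s • m) = s ^ (p ^ j) • ψ m := hψ s m
    have h2 : φ ((s ^ (p ^ j)) • ψ m) = (s ^ (p ^ j)) ^ (p ^ i) • φ (ψ m) := hφ _ _
    change φ (ψ (s • m)) = s ^ (p ^ (i + j)) • φ (ψ m)
    rw [h1, h2, ← pow_mul, ← pow_add, add_comm]

/-- The algebra of Frobenius maps `𝓕(M) = ⨁_{e ≥ 0} 𝓕^e(M)` (external direct sum). Its ring
structure is the one for which the product of homogeneous elements is their composition. -/
abbrev FrobeniusAlgebra : Type v := ⨁ e, frobeniusMaps p S M e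

/-- The canonical ring homomorphism `Hom_S(M, M) = 𝓕^0(M) → 𝓕(M)`. -/
def ofEnd : Module.End S M →+* FrobeniusAlgebra p S M where
  toFun φ := DirectSum.of (fun e => frobeniusMaps p S M e) 0
    ⟨φ.toAddMonoidHom, fun s m => by
      rw [pow_zero, pow_one]
      exact φ.map_smul s m⟩
  map_one' := rfl
  map_mul' φ ψ := by
    rw [DirectSum.of_mul_of]
    rfl
  map_zero' := by
    rw [← map_zero (DirectSum.of (fun e => frobeniusMaps p S M e) 0)]
    rfl
  map_add' φ ψ := by
    rw [← map_add (DirectSum.of (fun e => frobeniusMaps p S M e) 0)]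
    rfl

end FrobeniusAlgebra

/-- For a homomorphism `f : A → B` of (not necessarily commutative) rings, whose image need not be
central: `B` is finitely generated as an `A`-algebra, i.e. some finite subset of `B` together with
the image of `A` generates `B` as a ring. -/
def FinitelyGeneratedOver {A : Type u} {B : Type v} [Ring A] [Ring B] (f : A →+* B) : Prop :=
  ∃ T : Finset B, Subring.closure (Set.range f ∪ (T : Set B)) = ⊤

/-- `i : M → E` is an injective hull of the `S`-module `M`: `E` is an injective module and `i` is an
essential monomorphism. The modules lie in the universe of `S`, where Mathlib's `Module.Injective`
is injectivity in the usual sense. -/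
structure IsInjectiveHull {S : Type u} [CommRing S] {M E : Type u} [AddCommGroup M] [Module S M]
    [AddCommGroup E] [Module S E] (i : M →ₗ[S] E) : Prop where
  injective_module : Module.Injective S E
  injective_map : Function.Injective i
  essential : ∀ N : Submodule S E, N ⊓ LinearMap.range i = ⊥ → N = ⊥

section Ideals

variable {R : Type u} [CommRing R]

/-- `J^{[q]}`, the ideal generated by the `q`-th powers of the elements of `J`. -/
def frobeniusPower (J : Ideal R) (q : ℕ) : Ideal R :=
  Ideal.span ((fun a => a ^ q) '' (J : Set R))

/-- `K_e = (I^{[p^e]} : I)`. -/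
def idealK (p : ℕ) (I : Ideal R) (e : ℕ) : Ideal R :=
  Submodule.colon (frobeniusPower I (p ^ e)) (I : Set R)

/-- `L_e`, the sum, over all `s` and all `β_1, …, β_s` with `1 ≤ β_j < e` and
`β_1 + ⋯ + β_s = e`, of the ideals
`K_{β_1} K_{β_2}^{[p^{β_1}]} K_{β_3}^{[p^{β_1+β_2}]} ⋯ K_{β_s}^{[p^{β_1+⋯+β_{s-1}}]}`. -/
def idealL (p : ℕ) (I : Ideal R) (e : ℕ) : Ideal R :=
  ⨆ (s : ℕ) (β : Fin s → ℕ) (_ : (∀ j, 1 ≤ β j ∧ β j < e) ∧ ∑ j, β j = e),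
    ∏ j, frobeniusPower (idealK p I (β j)) (p ^ ∑ i ∈ Finset.Iio j, β i)

end Ideals

section Example

variable (K : Type u) [Field K]

/-- `R = K[[x, y, z]]`. -/
abbrev R : Type u := MvPowerSeries (Fin 3) K

/-- The variable `x` of `R`. -/
noncomputable def x : R K := MvPowerSeries.X 0

/-- The variable `y` of `R`. -/
noncomputable def y : R K := MvPowerSeries.X 1

/-- The variable `z` of `R`. -/
noncomputable def z : R K := MvPowerSeries.X 2

/-- `I = (xy, yz)`. -/
noncomputable def I : Ideal (R K) := Ideal.span {x K * y K, y K * z K}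

/-- `S = R / I`. -/
abbrev S : Type u := R K ⧸ I K

instance S_nontrivial : Nontrivial (S K) := by
  refine Ideal.Quotient.nontrivial_iff.mpr fun h => ?_
  have hle : I K ≤ RingHom.ker (MvPowerSeries.constantCoeff (σ := Fin 3) (R := K)) := by
    rw [I, Ideal.span_le]
    rintro a (rfl | rfl) <;> simp [x, y, z, RingHom.mem_ker]
  have h1 := hle (h ▸ Submodule.mem_top : (1 : R K) ∈ I K)
  simp [RingHom.mem_ker] at h1

instance S_isLocalRing : IsLocalRing (S K) :=
  IsLocalRing.of_surjective' (Ideal.Quotient.mk (I K)) Ideal.Quotient.mk_surjective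

end Example

end FrobeniusMaps

/-! Write `q = p ^ e`. Ideals: apart from `x ^ q * y ^ (q - 1)`, the generators of `K_e` are
divisible by `z` when `e ≥ 1`, so modulo `z` only powers of `x` matter. In a product defining `L_e`
the last factor contributes `x ^ q`, and since there are at least two factors another one
contributes one more `x`. Hence `L_e` lies in `(x ^ (q + 1), z)`, which misses `x ^ q * y ^ (q - 1)`
(`idealL_le`).

Duality: fix a socle generator `σ` of `E` and a `K`-linear `τ : E → K` with `τ σ = 1`. Then `(s, e)
↦ τ (s • e)` is a nondegenerate pairing, and injectivity yields elements `w a b c` dual to the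
monomials surviving in `S`. As every element of `E` is torsion, these inverse monomials span `E`. An
endomorphism is therefore determined by the power series of its values under `τ`, which gives
`bijective_algebraMap_end`.

Non-generation: `frobeniusFun` is the map on inverse monomials corresponding to `x ^ q * y ^ (q -
1)`; it sends `w 1 0 0` to `w (q - 1) 0 (q - 1)`, so `x ^ (q - 1) * z ^ (q - 1)` takes the image to
the nonzero `w 0 0 0`. A composite of two Frobenius maps of positive degree cannot do this
(`mul_mem_socleVanishing`): the socle of `E` is contained in `y E`, so a Frobenius map of positive
degree sends it to elements divisible by `y ^ q`, killed by `z ^ (q - 1)` because `yz = 0`. Every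
degree thus requires a new generator. -/

namespace FrobeniusMaps

/-! ### Monomial ideals in power series rings. -/

/-- A power series lies in the ideal generated by finitely many monomials if and only if each of
its terms is divisible by one of them. -/
theorem mem_span_monomial_iff {σ A : Type*} [CommRing A] (G : Finset (σ →₀ ℕ))
    (f : MvPowerSeries σ A) :
    f ∈ Ideal.span ((fun g => MvPowerSeries.monomial g (1 : A)) '' (G : Set (σ →₀ ℕ))) ↔
      ∀ d, MvPowerSeries.coeff d f ≠ 0 → ∃ g ∈ G, g ≤ d := by
  classical
  constructor
  · intro hf
    induction hf using Submodule.span_induction with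
    | mem a ha =>
      obtain ⟨g, hg, rfl⟩ := ha
      exact fun d hd => ⟨g, hg, (MvPowerSeries.eq_of_coeff_monomial_ne_zero hd).ge⟩
    | zero => exact fun d hd => absurd (map_zero _) hd
    | add a b _ _ iha ihb =>
      intro d hd
      by_cases h : MvPowerSeries.coeff d a = 0
      · exact ihb d fun h' => hd (by rw [map_add, h, h', add_zero])
      · exact iha d h
    | smul r a _ iha =>
      intro d hd
      rw [smul_eq_mul, MvPowerSeries.coeff_mul] at hd
      obtain ⟨⟨m, n⟩, hmn, h⟩ := Finset.exists_ne_zero_of_sum_ne_zero hd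
      obtain ⟨g, hg, hgn⟩ := iha n (right_ne_zero_of_mul h)
      rw [Finset.HasAntidiagonal.mem_antidiagonal] at hmn
      exact ⟨g, hg, hgn.trans (hmn ▸ le_add_self)⟩
  · intro h
    have h' : ∀ d, ∃ g, MvPowerSeries.coeff d f ≠ 0 → g ∈ G ∧ g ≤ d := fun d => by
      by_cases hd : MvPowerSeries.coeff d f = 0
      · exact ⟨0, fun h0 => absurd hd h0⟩
      · obtain ⟨g, hg⟩ := h d hd
        exact ⟨g, fun _ => hg⟩
    choose γ hγ using h'
    -- Each exponent `d` is assigned to one generator `γ d`, so `r g` is the quotient by `g` of the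
    -- part of `f` assigned to `g`. The arbitrary value of `γ` where the coefficient vanishes
    -- contributes nothing.
    let r : (σ →₀ ℕ) → MvPowerSeries σ A := fun g m =>
      if γ (m + g) = g then MvPowerSeries.coeff (m + g) f else 0
    have hr : ∀ g m, MvPowerSeries.coeff m (r g) =
      if γ (m + g) = g then MvPowerSeries.coeff (m + g) f else 0 := fun _ _ => rfl
    have key : f = ∑ g ∈ G, r g * MvPowerSeries.monomial g 1 := by
      ext d
      rw [map_sum]
      simp_rw [MvPowerSeries.coeff_mul_monomial, mul_one, hr]
      by_cases hd : MvPowerSeries.coeff d f = 0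
      · rw [hd, Finset.sum_eq_zero]
        intro g _
        split_ifs with hgd h
        · rwa [tsub_add_cancel_of_le hgd]
        · rfl
        · rfl
      · obtain ⟨h1, h2⟩ := hγ d hd
        rw [Finset.sum_eq_single_of_mem (γ d) h1]
        · rw [if_pos h2, tsub_add_cancel_of_le h2, if_pos rfl]
        · intro g _ hg
          split_ifs with hgd h
          · rw [tsub_add_cancel_of_le hgd] at h
            exact absurd h.symm hg
          · rfl
          · rfl
    rw [key]
    exact Ideal.sum_mem _ fun g hg =>
      Ideal.mul_mem_left _ _ (Ideal.subset_span ⟨g, hg, rfl⟩)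

/-- The exponent of `x ^ a * y ^ b * z ^ c`. -/
noncomputable def expo (a b c : ℕ) : Fin 3 →₀ ℕ :=
  Finsupp.single 0 a + Finsupp.single 1 b + Finsupp.single 2 c

@[simp] theorem expo_apply_zero (a b c : ℕ) : expo a b c 0 = a := by simp [expo]

@[simp] theorem expo_apply_one (a b c : ℕ) : expo a b c 1 = b := by simp [expo]

@[simp] theorem expo_apply_two (a b c : ℕ) : expo a b c 2 = c := by simp [expo]

theorem expo_eta (d : Fin 3 →₀ ℕ) : expo (d 0) (d 1) (d 2) = d := by
  ext i; fin_cases i <;> simp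

theorem expo_le_iff {a b c : ℕ} {d : Fin 3 →₀ ℕ} :
    expo a b c ≤ d ↔ a ≤ d 0 ∧ b ≤ d 1 ∧ c ≤ d 2 := by
  simp [Finsupp.le_def, Fin.forall_fin_succ]

theorem expo_inj {a b c a' b' c' : ℕ} :
    expo a b c = expo a' b' c' ↔ a = a' ∧ b = b' ∧ c = c' := by
  constructor
  · intro h
    exact ⟨by simpa using DFunLike.congr_fun h 0, by simpa using DFunLike.congr_fun h 1,
      by simpa using DFunLike.congr_fun h 2⟩
  · rintro ⟨rfl, rfl, rfl⟩; rfl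

theorem expo_sub (a b c a' b' c' : ℕ) :
    expo a b c - expo a' b' c' = expo (a - a') (b - b') (c - c') := by
  ext i; fin_cases i <;> simp

section

variable (K : Type u) [Field K]

theorem monomial_expo (a b c : ℕ) :
    MvPowerSeries.monomial (expo a b c) (1 : K) = x K ^ a * y K ^ b * z K ^ c := by
  simp [x, y, z, MvPowerSeries.X_pow_eq, MvPowerSeries.monomial_mul_monomial, expo]

variable {K}

/-- The coefficient of `x ^ a * y ^ b * z ^ c`. -/
noncomputable abbrev coeffAt (a b c : ℕ) : R K →ₗ[K] K := MvPowerSeries.coeff (expo a b c)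

theorem coeffAt_monomial_mul (a b c i j k : ℕ) (f : R K) :
    coeffAt a b c (x K ^ i * y K ^ j * z K ^ k * f) =
      if i ≤ a ∧ j ≤ b ∧ k ≤ c then coeffAt (a - i) (b - j) (c - k) f else 0 := by
  classical
  rw [← monomial_expo, coeffAt, MvPowerSeries.coeff_monomial_mul]
  simp [expo_le_iff, expo_sub]

theorem coeffAt_monomial (a b c i j k : ℕ) :
    coeffAt a b c (x K ^ i * y K ^ j * z K ^ k) = if a = i ∧ b = j ∧ c = k then 1 else 0 := by
  classical
  rw [← monomial_expo, coeffAt, MvPowerSeries.coeff_monomial]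
  simp [expo_inj]

theorem mem_span_pair_iff (i j k i' j' k' : ℕ) (f : R K) :
    f ∈ Ideal.span {x K ^ i * y K ^ j * z K ^ k, x K ^ i' * y K ^ j' * z K ^ k'} ↔
      ∀ a b c, coeffAt a b c f ≠ 0 → (i ≤ a ∧ j ≤ b ∧ k ≤ c) ∨ (i' ≤ a ∧ j' ≤ b ∧ k' ≤ c) := by
  classical
  have := mem_span_monomial_iff {expo i j k, expo i' j' k'} f
  rw [Finset.coe_pair, Set.image_pair, monomial_expo, monomial_expo] at this
  rw [this]
  refine ⟨fun h a b c hf => ?_, fun h d hd => ?_⟩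
  · simpa [expo_le_iff] using h _ hf
  · rw [← expo_eta d] at hd
    simpa [expo_le_iff] using h _ _ _ hd

theorem mem_span_triple_iff (i j k i' j' k' i'' j'' k'' : ℕ) (f : R K) :
    f ∈ Ideal.span {x K ^ i * y K ^ j * z K ^ k, x K ^ i' * y K ^ j' * z K ^ k',
        x K ^ i'' * y K ^ j'' * z K ^ k''} ↔
      ∀ a b c, coeffAt a b c f ≠ 0 → (i ≤ a ∧ j ≤ b ∧ k ≤ c) ∨ (i' ≤ a ∧ j' ≤ b ∧ k' ≤ c) ∨
        (i'' ≤ a ∧ j'' ≤ b ∧ k'' ≤ c) := by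
  classical
  have := mem_span_monomial_iff {expo i j k, expo i' j' k', expo i'' j'' k''} f
  rw [Finset.coe_insert, Finset.coe_pair, Set.image_insert_eq, Set.image_pair, monomial_expo,
    monomial_expo, monomial_expo] at this
  rw [this]
  refine ⟨fun h a b c hf => ?_, fun h d hd => ?_⟩
  · simpa [expo_le_iff] using h _ hf
  · rw [← expo_eta d] at hd
    simpa [expo_le_iff] using h _ _ _ hd

theorem mem_I_iff (f : R K) :
    f ∈ I K ↔ ∀ a b c, coeffAt a b c f ≠ 0 → 1 ≤ b ∧ (1 ≤ a ∨ 1 ≤ c) := by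
  have := mem_span_pair_iff 1 1 0 0 1 1 f
  simp only [pow_one, pow_zero, mul_one, one_mul] at this
  rw [I, this]
  refine forall₃_congr fun a b c => imp_congr_right fun _ => ?_
  omega

end

/-! ### Frobenius powers and the ideals `K_e` and `L_e`. -/

section FrobeniusPower

variable {A : Type u} [CommRing A] (p : ℕ) [ExpChar A p]

theorem frobeniusPower_eq_map (J : Ideal A) (e : ℕ) :
    frobeniusPower J (p ^ e) = J.map (iterateFrobenius A p e) := rfl

theorem frobeniusPower_span (s : Set A) (e : ℕ) :
    frobeniusPower (Ideal.span s) (p ^ e) = Ideal.span ((fun a => a ^ p ^ e) '' s) := by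
  rw [frobeniusPower_eq_map, Ideal.map_span]
  rfl

end FrobeniusPower

section IdealKL

variable {K : Type u} [Field K] {p : ℕ}

instance charP_R [CharP K p] : CharP (R K) p :=
  charP_of_injective_algebraMap (algebraMap K (R K)).injective p

variable [hp : Fact p.Prime] [CharP K p]

/-- The colon is tested on the generators `xy` and `yz`. All ideals involved are monomial, so only
inequalities between exponents remain. -/
theorem idealK_eq_span {e : ℕ} :
    idealK p (I K) e = Ideal.span
        {x K ^ (p ^ e) * y K ^ (p ^ e - 1),
          x K ^ (p ^ e - 1) * y K ^ (p ^ e - 1) * z K ^ (p ^ e - 1),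
          y K ^ (p ^ e - 1) * z K ^ (p ^ e)} := by
  have hq : 1 ≤ p ^ e := Nat.one_le_pow _ _ hp.out.pos
  generalize hqe : p ^ e = q at hq
  have hI : frobeniusPower (I K) q =
      Ideal.span {x K ^ q * y K ^ q * z K ^ 0, x K ^ 0 * y K ^ q * z K ^ q} := by
    rw [← hqe, I, frobeniusPower_span p, Set.image_pair]
    simp [mul_pow]
  ext f
  have h3 := mem_span_triple_iff q (q - 1) 0 (q - 1) (q - 1) (q - 1) 0 (q - 1) q f
  simp only [pow_zero, mul_one, one_mul] at h3
  have hcol : f ∈ idealK p (I K) e ↔ (x K ^ 1 * y K ^ 1 * z K ^ 0) * f ∈ frobeniusPower (I K) q ∧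
      (x K ^ 0 * y K ^ 1 * z K ^ 1) * f ∈ frobeniusPower (I K) q := by
    rw [idealK, hqe, Submodule.mem_colon]
    constructor
    · intro h
      have h1 := h (x K * y K) (Ideal.subset_span (by simp))
      have h2 := h (y K * z K) (Ideal.subset_span (by simp))
      rw [smul_eq_mul, mul_comm] at h1 h2
      simpa using ⟨h1, h2⟩
    · rintro ⟨h1, h2⟩ a ha
      rw [pow_one, pow_one, pow_zero, mul_one, mul_comm] at h1
      rw [pow_one, pow_one, pow_zero, one_mul, mul_comm] at h2
      obtain ⟨s, t, rfl⟩ := Ideal.mem_span_pair.mp ha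
      rw [smul_add, smul_eq_mul, smul_eq_mul, mul_left_comm, mul_left_comm f t]
      exact add_mem (Ideal.mul_mem_left _ _ h1) (Ideal.mul_mem_left _ _ h2)
  rw [hcol, h3, hI, mem_span_pair_iff, mem_span_pair_iff]
  simp only [coeffAt_monomial_mul]
  constructor
  · rintro ⟨h1, h2⟩ a b c hf
    have h1' := h1 (a + 1) (b + 1) c (by simpa using hf)
    have h2' := h2 a (b + 1) (c + 1) (by simpa using hf)
    omega
  · intro h
    constructor
    · intro a b c hf
      rw [ne_eq, ite_eq_right_iff, not_forall] at hf
      obtain ⟨hle, hf⟩ := hf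
      have := h _ _ _ hf
      omega
    · intro a b c hf
      rw [ne_eq, ite_eq_right_iff, not_forall] at hf
      obtain ⟨hle, hf⟩ := hf
      have := h _ _ _ hf
      omega

/-- The ideal `(x ^ n, z)`. -/
noncomputable def idealV (K : Type u) [Field K] (n : ℕ) : Ideal (R K) :=
  Ideal.span {x K ^ n, z K}

theorem idealV_antitone {m n : ℕ} (h : m ≤ n) : idealV K n ≤ idealV K m := by
  rw [idealV, Ideal.span_le]
  rintro a (rfl | rfl)
  · exact Ideal.mem_of_dvd _ (pow_dvd_pow _ h) (Ideal.subset_span (by simp))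
  · exact Ideal.subset_span (by simp)

theorem idealV_mul_le (m n : ℕ) : idealV K m * idealV K n ≤ idealV K (m + n) := by
  have hz : z K ∈ idealV K (m + n) := Ideal.subset_span (by simp)
  rw [idealV, idealV, Ideal.span_mul_span', Ideal.span_le]
  rintro _ ⟨a, (rfl | rfl), b, (rfl | rfl), rfl⟩
  · change x K ^ m * x K ^ n ∈ _
    rw [← pow_add]
    exact Ideal.subset_span (by simp)
  · exact Ideal.mul_mem_left _ _ hz
  · exact Ideal.mul_mem_right _ _ hz
  · exact Ideal.mul_mem_right _ _ hz

/-- The two generators other than the first are divisible by `z` because `p ^ β - 1 ≥ 1`; this fails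
for `β = 0`. -/
theorem frobeniusPower_idealK_le (β t : ℕ) (hβ : 1 ≤ β) :
    frobeniusPower (idealK p (I K) β) (p ^ t) ≤ idealV K (p ^ (β + t)) := by
  have hp2 : 2 ≤ p ^ β := hp.out.two_le.trans (Nat.le_self_pow (by omega) p)
  have ht : p ^ t ≠ 0 := pow_ne_zero _ hp.out.ne_zero
  have hz : z K ∈ idealV K (p ^ (β + t)) := Ideal.subset_span (by simp)
  rw [idealK_eq_span, frobeniusPower_span, Ideal.span_le]
  rintro _ ⟨a, (rfl | rfl | rfl), rfl⟩
  · refine Ideal.mem_of_dvd _ ?_ (Ideal.subset_span (Set.mem_insert _ _))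
    simp only [mul_pow, ← pow_mul, ← pow_add]
    exact dvd_mul_right _ _
  all_goals
    refine Ideal.mem_of_dvd _ ?_ hz
    exact dvd_pow (dvd_mul_of_dvd_right (dvd_pow_self _ (by omega)) _) ht

/-- The conditions `β j < e` and `e ≥ 1` force at least two factors. The last one, with total
exponent `p ^ e`, lies in `(x ^ (p ^ e), z)`, and the first one in `(x, z)`. -/
theorem idealL_le {e : ℕ} (he : 1 ≤ e) : idealL p (I K) e ≤ idealV K (p ^ e + 1) := by
  refine iSup_le fun s => iSup_le fun β => iSup_le fun hβ => ?_
  obtain ⟨hβ, hsum⟩ := hβ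
  match s, β with
  | 0, β => simp at hsum; omega
  | 1, β =>
    have := (hβ 0).2
    simp at hsum
    omega
  | n + 2, β =>
    rw [Fin.prod_univ_castSucc, mul_comm]
    refine (Ideal.mul_mono ?_ ?_).trans (idealV_mul_le (p ^ e) 1)
    · refine (frobeniusPower_idealK_le _ _ (hβ _).1).trans (le_of_eq ?_)
      rw [← hsum, Fin.sum_univ_castSucc, add_comm]
      congr 3
      have : Finset.Iio (Fin.last (n + 1)) = Finset.univ.map Fin.castSuccEmb := by
        ext j
        simp [Fin.exists_castSucc_eq]
      rw [this, Finset.sum_map]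
      rfl
    · refine Ideal.prod_le_inf.trans ((Finset.inf_le (Finset.mem_univ 0)).trans ?_)
      exact (frobeniusPower_idealK_le _ _ (hβ _).1).trans
        (idealV_antitone (Nat.one_le_pow _ _ hp.out.pos))

theorem monomial_notMem_idealL {e : ℕ} (he : 1 ≤ e) :
    x K ^ (p ^ e) * y K ^ (p ^ e - 1) ∉ idealL p (I K) e := by
  intro h
  have h1 := idealL_le he h
  have h2 := mem_span_pair_iff (p ^ e + 1) 0 0 0 0 1 (x K ^ (p ^ e) * y K ^ (p ^ e - 1) * z K ^ 0)
  simp only [pow_zero, pow_one, mul_one, one_mul] at h2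
  have h3 := h2.mp h1 (p ^ e) (p ^ e - 1) 0 (by
    have := coeffAt_monomial (K := K) (p ^ e) (p ^ e - 1) 0 (p ^ e) (p ^ e - 1) 0
    rw [pow_zero, mul_one] at this
    rw [this]
    simp)
  omega

end IdealKL

/-! ### Truncation of power series and powers of the maximal ideal. -/

section Truncation

variable {K : Type u} [Field K]

/-- The ideal `(x ^ n, y ^ n, z ^ n)`. -/
noncomputable def idealJ (K : Type u) [Field K] (n : ℕ) : Ideal (R K) :=
  Ideal.span {x K ^ n, y K ^ n, z K ^ n}

theorem mem_idealJ_iff (n : ℕ) (f : R K) :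
    f ∈ idealJ K n ↔ ∀ a b c, coeffAt a b c f ≠ 0 → n ≤ a ∨ n ≤ b ∨ n ≤ c := by
  have := mem_span_triple_iff n 0 0 0 n 0 0 0 n f
  simpa [idealJ] using this

theorem idealJ_antitone {m n : ℕ} (h : m ≤ n) : idealJ K n ≤ idealJ K m := fun f hf => by
  rw [mem_idealJ_iff] at hf ⊢
  intro a b c habc
  have := hf a b c habc
  omega

/-- The part of a power series of degree less than `n` in each variable. -/
noncomputable def boxTrunc (n : ℕ) (f : R K) : R K :=
  ∑ d ∈ Finset.range n ×ˢ Finset.range n ×ˢ Finset.range n,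
    coeffAt d.1 d.2.1 d.2.2 f • (x K ^ d.1 * y K ^ d.2.1 * z K ^ d.2.2)

theorem sub_boxTrunc_mem (n : ℕ) (f : R K) : f - boxTrunc n f ∈ idealJ K n := by
  rw [mem_idealJ_iff]
  intro a b c h
  by_contra! hlt
  apply h
  rw [map_sub, sub_eq_zero, boxTrunc, map_sum, Finset.sum_eq_single_of_mem (a, b, c)]
  · simp only [map_smul, coeffAt_monomial]
    simp
  · simpa using hlt
  · rintro ⟨i, j, k⟩ _ hne
    rw [map_smul, coeffAt_monomial, if_neg, smul_zero]
    rintro ⟨rfl, rfl, rfl⟩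
    exact hne rfl

theorem coeff_eq_zero_of_mem_ker_pow (n : ℕ) {f : R K}
    (hf : f ∈ RingHom.ker (MvPowerSeries.constantCoeff (σ := Fin 3) (R := K)) ^ n)
    {d : Fin 3 →₀ ℕ} (hd : d.degree < n) : MvPowerSeries.coeff d f = 0 := by
  classical
  induction n generalizing f d with
  | zero => omega
  | succ n ih =>
    rw [pow_succ] at hf
    induction hf using Submodule.mul_induction_on' with
    | mem_mul_mem g hg h hh =>
      rw [MvPowerSeries.coeff_mul]
      refine Finset.sum_eq_zero fun ⟨i, j⟩ hij => ?_
      rw [Finset.HasAntidiagonal.mem_antidiagonal] at hij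
      change i + j = d at hij
      by_cases hj : j = 0
      · have : MvPowerSeries.coeff j h = 0 := by
          rw [hj, MvPowerSeries.coeff_zero_eq_constantCoeff_apply]
          exact hh
        rw [this, mul_zero]
      · have hdeg : i.degree + j.degree = d.degree := by rw [← hij, map_add]
        have hj' : j.degree ≠ 0 := fun h0 => hj ((Finsupp.degree_eq_zero_iff j).mp h0)
        have hi : MvPowerSeries.coeff i g = 0 := ih hg (by omega)
        rw [hi, zero_mul]
    | add a _ b _ ha hb => rw [map_add, ha, hb, add_zero]

theorem monomial_mem_I {a b c : ℕ} (h : ¬ (b = 0 ∨ (a = 0 ∧ c = 0))) :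
    x K ^ a * y K ^ b * z K ^ c ∈ I K := by
  rw [mem_I_iff]
  intro i j k hijk
  rw [coeffAt_monomial, ne_eq, ite_eq_right_iff, not_forall] at hijk
  obtain ⟨⟨rfl, rfl, rfl⟩, _⟩ := hijk
  omega

end Truncation

/-! ### The socle of `E` and torsion. -/

section Socle

variable {K : Type u} [Field K]

/-- The quotient map `R → S`. -/
noncomputable abbrev mkS (K : Type u) [Field K] : R K →+* S K := Ideal.Quotient.mk (I K)

theorem mkS_mem_maximalIdeal {r : R K} (hr : MvPowerSeries.constantCoeff r = 0) :
    mkS K r ∈ IsLocalRing.maximalIdeal (S K) := by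
  rw [IsLocalRing.mem_maximalIdeal, mem_nonunits_iff]
  intro hu
  have hI : ∀ a ∈ I K, MvPowerSeries.constantCoeff a = 0 := fun a ha => by
    by_contra h
    have h0 : expo 0 0 0 = 0 := by simp [expo]
    have := (mem_I_iff a).mp ha 0 0 0 (by
      rwa [coeffAt, h0, MvPowerSeries.coeff_zero_eq_constantCoeff_apply])
    omega
  have := hu.map (Ideal.Quotient.lift (I K) MvPowerSeries.constantCoeff hI)
  rw [Ideal.Quotient.lift_mk, hr] at this
  exact not_isUnit_zero this

/-- If no power of the maximal ideal killed the cyclic module `S e`, each `𝔪 ^ n • S e` would be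
nonzero and so contain `σ`, against Krull's intersection theorem. -/
theorem exists_maximalIdeal_pow_smul_eq_zero {E : Type u} [AddCommGroup E] [Module (S K) E]
    {σ : E} (hσ : σ ≠ 0)
    (hess : ∀ e : E, e ≠ 0 → ∃ s : S K, s • e = σ) (e : E) :
    ∃ n : ℕ, ∀ s ∈ IsLocalRing.maximalIdeal (S K) ^ n, s • e = 0 := by
  set N := Submodule.span (S K) {e} with hN
  have heN : e ∈ N := Submodule.mem_span_singleton_self e
  by_cases he : e = 0
  · exact ⟨0, fun s _ => by rw [he, smul_zero]⟩
  obtain ⟨s₀, hs₀⟩ := hess e he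
  have hσN : σ ∈ N := hs₀ ▸ N.smul_mem s₀ heN
  have krull := Ideal.iInf_pow_smul_eq_bot_of_isLocalRing (R := S K) (M := N)
    (IsLocalRing.maximalIdeal (S K)) (Ideal.IsPrime.ne_top inferInstance)
  have key : ∃ n : ℕ, IsLocalRing.maximalIdeal (S K) ^ n • (⊤ : Submodule (S K) N) = ⊥ := by
    by_contra! hne
    have hmem : (⟨σ, hσN⟩ : N) ∈
        (⨅ n : ℕ, IsLocalRing.maximalIdeal (S K) ^ n • ⊤ : Submodule (S K) N) := by
      rw [Submodule.mem_iInf]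
      intro n
      obtain ⟨t, ht, ht0⟩ := Submodule.exists_mem_ne_zero_of_ne_bot (hne n)
      obtain ⟨s, hs⟩ := hess t (fun h => ht0 (Subtype.ext h))
      have : (⟨σ, hσN⟩ : N) = s • t := Subtype.ext hs.symm
      rw [this]
      exact Submodule.smul_mem _ s ht
    rw [krull, Submodule.mem_bot] at hmem
    exact hσ (congrArg Subtype.val hmem)
  obtain ⟨n, hn⟩ := key
  refine ⟨n, fun s hs => ?_⟩
  have h1 : s • (⟨e, heN⟩ : N) ∈
      IsLocalRing.maximalIdeal (S K) ^ n • (⊤ : Submodule (S K) N) :=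
    Submodule.smul_mem_smul hs Submodule.mem_top
  rw [hn, Submodule.mem_bot] at h1
  exact congrArg Subtype.val h1

variable {E : Type u} [AddCommGroup E] [Module (S K) E] [Module K E] [IsScalarTower K (S K) E]

/-- `σ` generates the socle of the injective module `E`, which is an essential extension of it and
is torsion, and `τ` is a `K`-linear functional on `E` with `τ σ = 1`. -/
structure IsSocleFunctional (σ : E) (τ : E →ₗ[K] K) : Prop where
  baer : Module.Baer (S K) E
  apply_socle : τ σ = 1
  smul_socle : ∀ r : R K, mkS K r • σ = (MvPowerSeries.constantCoeff r) • σ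
  exists_smul_eq : ∀ e : E, e ≠ 0 → ∃ s : S K, s • e = σ
  torsion : ∀ e : E, ∃ n : ℕ, ∀ r ∈ idealJ K n, mkS K r • e = 0

theorem exists_isSocleFunctional
    (i : IsLocalRing.ResidueField (S K) →ₗ[S K] E) (hE : IsInjectiveHull i) :
    ∃ (σ : E) (τ : E →ₗ[K] K), IsSocleFunctional σ τ := by
  have hi : ∀ s : S K, s • i 1 = i (IsLocalRing.residue (S K) s) := fun s => by
    rw [← map_smul, Algebra.smul_def, mul_one]
    rfl
  have hσ : i 1 ≠ 0 := fun h =>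
    one_ne_zero (hE.injective_map (h.trans (map_zero i).symm))
  have hess : ∀ e : E, e ≠ 0 → ∃ s : S K, s • e = i 1 := by
    intro e he
    have hne : Submodule.span (S K) {e} ⊓ LinearMap.range i ≠ ⊥ := fun h =>
      he (Submodule.span_singleton_eq_bot.mp (hE.essential _ h))
    obtain ⟨t, ⟨ht1, c, rfl⟩, ht0⟩ := Submodule.exists_mem_ne_zero_of_ne_bot hne
    obtain ⟨s, hs⟩ := Submodule.mem_span_singleton.mp ht1
    have hc : c ≠ 0 := fun h => ht0 (by rw [h, map_zero])
    obtain ⟨s', hs'⟩ := IsLocalRing.residue_surjective (R := S K) c⁻¹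
    refine ⟨s' * s, ?_⟩
    rw [mul_smul, hs, ← map_smul, Algebra.smul_def, IsLocalRing.ResidueField.algebraMap_eq, hs',
      inv_mul_cancel₀ hc]
  obtain ⟨τ₀, hτ₀⟩ : ∃ τ₀ : E →ₗ[K] K, τ₀ (i 1) ≠ 0 := by
    by_contra! h0
    exact hσ ((Module.forall_dual_apply_eq_zero_iff K (i 1)).mp h0)
  refine ⟨i 1, (τ₀ (i 1))⁻¹ • τ₀, Module.Baer.of_injective hE.injective_module, ?_, ?_, hess, ?_⟩
  · simp [inv_mul_cancel₀ hτ₀]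
  · intro r
    rw [← sub_eq_zero, ← algebraMap_smul (S K) (MvPowerSeries.constantCoeff r) (i 1), ← sub_smul]
    have : mkS K r - algebraMap K (S K) (MvPowerSeries.constantCoeff r) =
        mkS K (r - MvPowerSeries.C (MvPowerSeries.constantCoeff r)) := by
      rw [map_sub]
      rfl
    have hm := mkS_mem_maximalIdeal (r := r - MvPowerSeries.C (MvPowerSeries.constantCoeff r))
      (by rw [map_sub, MvPowerSeries.constantCoeff_C, sub_self])
    rw [this, hi, (IsLocalRing.residue_eq_zero_iff _).mpr hm, map_zero]
  · intro e
    obtain ⟨n, hn⟩ := exists_maximalIdeal_pow_smul_eq_zero hσ hess e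
    refine ⟨n, fun r hr => hn _ ?_⟩
    have : idealJ K n ≤ (IsLocalRing.maximalIdeal (S K) ^ n).comap (mkS K) := by
      rw [idealJ, Ideal.span_le]
      rintro _ (rfl | rfl | rfl)
      all_goals
        rw [SetLike.mem_coe, Ideal.mem_comap, map_pow]
        exact Ideal.pow_mem_pow (mkS_mem_maximalIdeal (by simp [x, y, z])) n
    exact this hr


end Socle

/-! ### The pairing `τ (s • e)` and Matlis duality. -/

namespace IsSocleFunctional

variable {K : Type u} [Field K] {E : Type u} [AddCommGroup E] [Module (S K) E]

theorem mkS_smul_eq_boxTrunc {n : ℕ} {e : E} (he : ∀ r ∈ idealJ K n, mkS K r • e = 0) (r : R K) :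
    mkS K r • e = mkS K (boxTrunc n r) • e := by
  rw [← sub_eq_zero, ← sub_smul, ← map_sub]
  exact he _ (sub_boxTrunc_mem n r)

variable [Module K E]

variable {σ : E} {τ : E →ₗ[K] K}

theorem eq_zero_of_forall (h : IsSocleFunctional σ τ) {e : E} (he : ∀ s : S K, τ (s • e) = 0) :
    e = 0 := by
  by_contra hne
  obtain ⟨s, hs⟩ := h.exists_smul_eq e hne
  exact one_ne_zero (h.apply_socle.symm.trans (hs ▸ he s))

theorem ext_smul (h : IsSocleFunctional σ τ) {e e' : E}
    (he : ∀ r : R K, τ (mkS K r • e) = τ (mkS K r • e')) : e = e' := by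
  rw [← sub_eq_zero]
  refine h.eq_zero_of_forall fun s => ?_
  obtain ⟨r, rfl⟩ := Ideal.Quotient.mk_surjective s
  rw [smul_sub, map_sub, sub_eq_zero]
  exact he r

theorem dual_monomial_eq_zero (h : IsSocleFunctional σ τ) {w : ℕ → ℕ → ℕ → E}
    (hw : ∀ a b c, ∀ r : R K, τ (mkS K r • w a b c) =
      if b = 0 ∨ (a = 0 ∧ c = 0) then coeffAt a b c r else 0) {a b c : ℕ}
    (habc : ¬ (b = 0 ∨ (a = 0 ∧ c = 0))) : w a b c = 0 :=
  h.ext_smul fun r => by rw [hw, if_neg habc, smul_zero, map_zero]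

variable [IsScalarTower K (S K) E]

theorem smul_scalar_comm (s : S K) (a : K) (e : E) : s • a • e = a • s • e :=
  smul_algebra_smul_comm a s e

theorem mkS_smul_smul (a : K) (r : R K) (e : E) : mkS K (a • r) • e = a • mkS K r • e :=
  smul_assoc a (mkS K r) e

/-- Since `e - e'` is torsion, a power series acts on it through a polynomial truncation, so testing
against monomials suffices. -/
theorem ext_monomial (h : IsSocleFunctional σ τ) {e e' : E}
    (he : ∀ a b c, τ (mkS K (x K ^ a * y K ^ b * z K ^ c) • e) =
      τ (mkS K (x K ^ a * y K ^ b * z K ^ c) • e')) : e = e' := by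
  rw [← sub_eq_zero]
  obtain ⟨n, hn⟩ := h.torsion (e - e')
  refine h.ext_smul fun r => ?_
  rw [smul_zero, mkS_smul_eq_boxTrunc hn, boxTrunc, map_sum, Finset.sum_smul, map_sum, map_zero]
  refine Finset.sum_eq_zero fun d _ => ?_
  rw [mkS_smul_smul, map_smul, smul_sub, map_sub, he, sub_self, smul_zero]

/-- Surjectivity of `E` onto the functionals continuous for the `𝔪`-adic topology, by induction on
`n`: Baer's criterion represents `f` on `𝔪 ^ n`, and the difference then vanishes on `𝔪 ^ n`. -/
theorem exists_forall_apply_smul_eq (h : IsSocleFunctional σ τ) (n : ℕ) (f : S K →ₗ[K] K)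
    (hf : ∀ r ∈ RingHom.ker (MvPowerSeries.constantCoeff (σ := Fin 3) (R := K)) ^ n,
      f (mkS K r) = 0) :
    ∃ e : E, ∀ s : S K, τ (s • e) = f s := by
  induction n generalizing f with
  | zero =>
    refine ⟨0, fun s => ?_⟩
    obtain ⟨r, rfl⟩ := Ideal.Quotient.mk_surjective s
    rw [smul_zero, map_zero, hf r (by simp)]
  | succ n ih =>
    let 𝔪 := RingHom.ker (MvPowerSeries.constantCoeff (σ := Fin 3) (R := K))
    let 𝔞 : Ideal (S K) := (𝔪 ^ n).map (mkS K)
    -- As `f` kills `𝔪 ^ (n + 1)`, a scalar acts on the restriction of `f` to `𝔪 ^ n` through its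
    -- constant term, exactly as it acts on `σ`. This makes `t ↦ f t • σ` linear over `S`.
    have hlin : ∀ (s t : S K), t ∈ 𝔞 → f (s * t) • σ = s • f t • σ := by
      intro s t ht
      obtain ⟨r, rfl⟩ := Ideal.Quotient.mk_surjective s
      obtain ⟨r', hr', rfl⟩ := (Ideal.mem_map_iff_of_surjective _
        Ideal.Quotient.mk_surjective).mp ht
      have h1 : f (mkS K ((r - MvPowerSeries.C (MvPowerSeries.constantCoeff r)) * r')) = 0 := by
        apply hf
        rw [pow_succ']
        exact Ideal.mul_mem_mul (by simp [RingHom.mem_ker]) hr'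
      rw [sub_mul, ← MvPowerSeries.smul_eq_C_mul, map_sub, map_sub, sub_eq_zero] at h1
      have h2 : mkS K (MvPowerSeries.constantCoeff r • r') =
        MvPowerSeries.constantCoeff r • mkS K r' := rfl
      rw [h2, map_smul, map_mul] at h1
      rw [h1, smul_eq_mul, mul_comm, mul_smul, ← h.smul_socle, ← smul_scalar_comm]
    let g : 𝔞 →ₗ[S K] E :=
      { toFun := fun t => f t • σ
        map_add' := fun s t => by rw [Submodule.coe_add, map_add, add_smul]
        map_smul' := fun s t => hlin s t t.2 }
    obtain ⟨g', hg'⟩ := h.baer 𝔞 g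
    have hval : ∀ s, g' s = s • g' 1 := fun s => by rw [← map_smul, smul_eq_mul, mul_one]
    let f' : S K →ₗ[K] K := τ ∘ₗ (LinearMap.toSpanSingleton (S K) E (g' 1)).restrictScalars K
    obtain ⟨e, he⟩ := ih (f - f') fun r hr => by
      have h1 := hg' (mkS K r) (Ideal.mem_map_of_mem _ hr)
      change f (mkS K r) - τ (mkS K r • g' 1) = 0
      rw [← hval, h1]
      change f (mkS K r) - τ (f (mkS K r) • σ) = 0
      rw [map_smul, h.apply_socle, smul_eq_mul, mul_one, sub_self]
    refine ⟨e + g' 1, fun s => ?_⟩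
    rw [smul_add, map_add, he]
    exact sub_add_cancel _ _

theorem exists_dual_monomial (h : IsSocleFunctional σ τ) (a b c : ℕ)
    (habc : b = 0 ∨ (a = 0 ∧ c = 0)) :
    ∃ e : E, ∀ r : R K, τ (mkS K r • e) = coeffAt a b c r := by
  have hI : (I K).restrictScalars K ≤ LinearMap.ker (coeffAt (K := K) a b c) := by
    intro r hr
    rw [LinearMap.mem_ker]
    by_contra h0
    have := (mem_I_iff r).mp hr a b c h0
    omega
  let f : S K →ₗ[K] K := ((I K).restrictScalars K).liftQ (coeffAt a b c) hI ∘ₗ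
    (Submodule.Quotient.restrictScalarsEquiv K (I K)).symm.toLinearMap
  have hf : ∀ r, f (mkS K r) = coeffAt a b c r := fun r => rfl
  obtain ⟨e, he⟩ := h.exists_forall_apply_smul_eq ((expo a b c).degree + 1) f fun r hr => by
    rw [hf]
    exact coeff_eq_zero_of_mem_ker_pow _ hr (Nat.lt_succ_self _)
  exact ⟨e, fun r => (he _).trans (hf r)⟩

/-- The inverse monomials in `E`: `w a b c` is dual to `x ^ a * y ^ b * z ^ c`, and is `0` if this
monomial vanishes in `S`. -/
theorem exists_dual_monomials (h : IsSocleFunctional σ τ) :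
    ∃ w : ℕ → ℕ → ℕ → E, ∀ a b c, ∀ r : R K, τ (mkS K r • w a b c) =
      if b = 0 ∨ (a = 0 ∧ c = 0) then coeffAt a b c r else 0 := by
  have : ∀ a b c, ∃ e : E, ∀ r : R K, τ (mkS K r • e) =
      if b = 0 ∨ (a = 0 ∧ c = 0) then coeffAt a b c r else 0 := by
    intro a b c
    split_ifs with habc
    · exact h.exists_dual_monomial a b c habc
    · exact ⟨0, fun r => by rw [smul_zero, map_zero]⟩
  choose w hw using this
  exact ⟨w, hw⟩

theorem eq_sum_dual_monomials (h : IsSocleFunctional σ τ) {w : ℕ → ℕ → ℕ → E}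
    (hw : ∀ a b c, ∀ r : R K, τ (mkS K r • w a b c) =
      if b = 0 ∨ (a = 0 ∧ c = 0) then coeffAt a b c r else 0) {n : ℕ} {e : E}
    (he : ∀ r ∈ idealJ K n, mkS K r • e = 0) :
    e = ∑ d ∈ Finset.range n ×ˢ Finset.range n ×ˢ Finset.range n,
      τ (mkS K (x K ^ d.1 * y K ^ d.2.1 * z K ^ d.2.2) • e) • w d.1 d.2.1 d.2.2 := by
  refine h.ext_monomial fun a b c => ?_
  rw [Finset.smul_sum, map_sum]
  by_cases hv : b = 0 ∨ (a = 0 ∧ c = 0)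
  · by_cases hlt : a < n ∧ b < n ∧ c < n
    · rw [Finset.sum_eq_single_of_mem (a, b, c) (by simpa using hlt)]
      · simp only []
        rw [smul_scalar_comm, τ.map_smul, hw, if_pos hv, coeffAt_monomial]
        simp
      · rintro ⟨i, j, k⟩ _ hne
        simp only []
        rw [smul_scalar_comm, τ.map_smul, hw, coeffAt_monomial, if_neg (c := i = a ∧ j = b ∧ k = c),
          ite_self, smul_zero]
        rintro ⟨rfl, rfl, rfl⟩
        exact hne rfl
    · rw [he, map_zero, Finset.sum_eq_zero]
      · rintro ⟨i, j, k⟩ hd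
        simp only [Finset.mem_product, Finset.mem_range] at hd
        simp only []
        rw [smul_scalar_comm, τ.map_smul, hw, coeffAt_monomial, if_neg (c := i = a ∧ j = b ∧ k = c),
          ite_self, smul_zero]
        omega
      · rw [mem_idealJ_iff]
        intro i j k hijk
        rw [coeffAt_monomial, ne_eq, ite_eq_right_iff, not_forall] at hijk
        obtain ⟨⟨rfl, rfl, rfl⟩, _⟩ := hijk
        omega
  · have h0 : mkS K (x K ^ a * y K ^ b * z K ^ c) = 0 :=
      Ideal.Quotient.eq_zero_iff_mem.mpr (monomial_mem_I hv)
    have hz : ∀ e' : E, mkS K (x K ^ a * y K ^ b * z K ^ c) • e' = 0 := fun e' => by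
      rw [h0]
      exact zero_smul (S K) e'
    rw [hz, map_zero, Finset.sum_eq_zero]
    intro d _
    rw [hz, map_zero]

/-- Matlis duality for `S`: every endomorphism of `E` is multiplication by a unique element. -/
theorem bijective_algebraMap_end (h : IsSocleFunctional σ τ) :
    Function.Bijective (algebraMap (S K) (Module.End (S K) E)) := by
  obtain ⟨w, hw⟩ := h.exists_dual_monomials
  constructor
  · rw [injective_iff_map_eq_zero]
    intro s hs
    obtain ⟨r, rfl⟩ := Ideal.Quotient.mk_surjective s
    rw [Ideal.Quotient.eq_zero_iff_mem, mem_I_iff]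
    intro a b c habc
    have h1 : mkS K r • w a b c = 0 := LinearMap.congr_fun hs (w a b c)
    have h2 := hw a b c r
    rw [h1, map_zero] at h2
    by_contra hv
    rw [if_pos (by omega)] at h2
    exact habc h2.symm
  · intro θ
    -- The only candidate: pairing `r` with `w a b c` must return the coefficient of `r` at `(a, b,
    -- c)`.
    let r : R K := fun d => τ (θ (w (d 0) (d 1) (d 2)))
    have hr : ∀ a b c, coeffAt a b c r = τ (θ (w a b c)) := fun a b c => by
      change τ (θ (w (expo a b c 0) (expo a b c 1) (expo a b c 2))) = _
      simp
    have key : ∀ e : E, τ (mkS K r • e) = τ (θ e) := by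
      have hbasis : ∀ a b c, τ (mkS K r • w a b c) = τ (θ (w a b c)) := fun a b c => by
        rw [hw]
        split_ifs with hv
        · exact hr a b c
        · rw [h.dual_monomial_eq_zero hw hv, map_zero, map_zero]
      intro e
      obtain ⟨n, hn⟩ := h.torsion e
      rw [h.eq_sum_dual_monomials hw hn, Finset.smul_sum, map_sum, map_sum, map_sum]
      refine Finset.sum_congr rfl fun d _ => ?_
      rw [smul_scalar_comm, τ.map_smul, hbasis,
        LinearMap.map_smul_of_tower θ, τ.map_smul]
    refine ⟨mkS K r, LinearMap.ext fun e => h.ext_smul fun t => ?_⟩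
    rw [Module.algebraMap_end_apply, ← map_smul θ, ← key, smul_comm]

end IsSocleFunctional

/-! ### An explicit Frobenius map in each degree. -/

namespace IsSocleFunctional

variable {K : Type u} [Field K] {E : Type u} [AddCommGroup E] [Module (S K) E] [Module K E]
  {σ : E} {τ : E →ₗ[K] K}

/-- Multiplication by monomials lowers the exponents of the inverse monomials. -/
theorem monomial_smul_dual_monomial (h : IsSocleFunctional σ τ) {w : ℕ → ℕ → ℕ → E}
    (hw : ∀ a b c, ∀ r : R K, τ (mkS K r • w a b c) =
      if b = 0 ∨ (a = 0 ∧ c = 0) then coeffAt a b c r else 0) (a c i j k : ℕ) :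
    mkS K (x K ^ i * y K ^ j * z K ^ k) • w a 0 c =
      if i ≤ a ∧ j = 0 ∧ k ≤ c then w (a - i) 0 (c - k) else 0 := by
  refine h.ext_smul fun r => ?_
  rw [← mul_smul, ← map_mul, hw, if_pos (Or.inl rfl), mul_comm, coeffAt_monomial_mul]
  simp only [nonpos_iff_eq_zero, Nat.zero_sub]
  split_ifs with hc
  · rw [hw, if_pos (Or.inl rfl)]
  · rw [smul_zero, map_zero]

/-- The additive map `E → E` with
`k x⁻ᵃ z⁻ᶜ ↦ k ^ q x ^ (-(q (a - 1) + q - 1)) z ^ (-(q c + q - 1))` for `a ≥ 1`, which kills the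
other inverse monomials. -/
noncomputable def frobeniusFun (τ : E →ₗ[K] K) (w : ℕ → ℕ → ℕ → E) (q : ℕ) (e : E) : E :=
  ∑ᶠ d : ℕ × ℕ, τ (mkS K (x K ^ (d.1 + 1) * z K ^ d.2) • e) ^ q •
    w (q * d.1 + (q - 1)) 0 (q * d.2 + (q - 1))

/-- The bounds `m` and `n` are free, so two expansions may be taken over ranges differing by a
shift. -/
theorem frobeniusFun_eq_sum {w : ℕ → ℕ → ℕ → E} {q : ℕ} (hq : q ≠ 0) {e : E} {m n : ℕ}
    (hm : mkS K (x K) ^ m • e = 0) (hn : mkS K (z K) ^ n • e = 0) :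
    frobeniusFun τ w q e = ∑ a ∈ Finset.range m, ∑ c ∈ Finset.range n,
      τ (mkS K (x K ^ (a + 1) * z K ^ c) • e) ^ q • w (q * a + (q - 1)) 0 (q * c + (q - 1)) := by
  rw [frobeniusFun, ← Finset.sum_product', finsum_eq_sum_of_support_subset]
  intro d hd
  rw [Finset.mem_coe, Finset.mem_product, Finset.mem_range, Finset.mem_range]
  by_contra hlt
  apply hd
  suffices h0 : mkS K (x K ^ (d.1 + 1) * z K ^ d.2) • e = 0 by
    simp only [h0, map_zero, zero_pow hq, zero_smul]
  rw [map_mul, map_pow, map_pow]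
  by_cases h1 : d.1 < m
  · obtain ⟨t, ht⟩ := Nat.exists_eq_add_of_le (show n ≤ d.2 by omega)
    rw [mul_smul, ht, add_comm n t, pow_add _ t n, mul_smul, hn, smul_zero, smul_zero]
  · obtain ⟨t, ht⟩ := Nat.exists_eq_add_of_le (show m ≤ d.1 + 1 by omega)
    rw [mul_comm, mul_smul, ht, add_comm m t, pow_add _ t m, mul_smul, hm, smul_zero, smul_zero]

theorem exists_pow_smul_eq_zero (h : IsSocleFunctional σ τ) (e : E) :
    ∃ n : ℕ, ∀ m, n ≤ m → mkS K (x K) ^ m • e = 0 ∧ mkS K (z K) ^ m • e = 0 := by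
  obtain ⟨n, hn⟩ := h.torsion e
  refine ⟨n, fun m hm => ?_⟩
  rw [← map_pow, ← map_pow]
  exact ⟨hn _ (idealJ_antitone hm (Ideal.subset_span (by simp))),
    hn _ (idealJ_antitone hm (Ideal.subset_span (by simp)))⟩

variable {p : ℕ} [hp : Fact p.Prime] [CharP K p]

theorem frobeniusFun_add (h : IsSocleFunctional σ τ) (w : ℕ → ℕ → ℕ → E) (t : ℕ) (e e' : E) :
    frobeniusFun τ w (p ^ t) (e + e') =
      frobeniusFun τ w (p ^ t) e + frobeniusFun τ w (p ^ t) e' := by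
  have hq : p ^ t ≠ 0 := pow_ne_zero _ hp.out.ne_zero
  obtain ⟨n, hn⟩ := h.exists_pow_smul_eq_zero e
  obtain ⟨n', hn'⟩ := h.exists_pow_smul_eq_zero e'
  have h1 := hn (max n n') (le_max_left _ _)
  have h2 := hn' (max n n') (le_max_right _ _)
  rw [frobeniusFun_eq_sum hq (m := max n n') (n := max n n'), frobeniusFun_eq_sum hq h1.1 h1.2,
    frobeniusFun_eq_sum hq h2.1 h2.2, ← Finset.sum_add_distrib]
  · refine Finset.sum_congr rfl fun a _ => ?_
    rw [← Finset.sum_add_distrib]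
    refine Finset.sum_congr rfl fun c _ => ?_
    rw [smul_add, map_add, add_pow_char_pow, add_smul]
  · rw [smul_add, h1.1, h2.1, add_zero]
  · rw [smul_add, h1.2, h2.2, add_zero]

variable [IsScalarTower K (S K) E]

theorem frobeniusFun_x_smul (h : IsSocleFunctional σ τ) {w : ℕ → ℕ → ℕ → E}
    (hw : ∀ a b c, ∀ r : R K, τ (mkS K r • w a b c) =
      if b = 0 ∨ (a = 0 ∧ c = 0) then coeffAt a b c r else 0) {q : ℕ} (hq : q ≠ 0) (e : E) :
    frobeniusFun τ w q (mkS K (x K) • e) = mkS K (x K) ^ q • frobeniusFun τ w q e := by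
  obtain ⟨n, hn⟩ := h.exists_pow_smul_eq_zero e
  have h1 := hn n le_rfl
  -- The right side is expanded with one extra term in `x`: its index `a = 0` gives the exponent `q
  -- - 1 < q` and dies under `x ^ q`, while the others shift down by one.
  rw [frobeniusFun_eq_sum hq (hn (n + 1) (by omega)).1 h1.2,
    frobeniusFun_eq_sum hq (m := n) (n := n), Finset.sum_range_succ', smul_add, Finset.smul_sum,
    Finset.smul_sum]
  · have hx : ∀ a c, mkS K (x K) ^ q • w a 0 c = if q ≤ a then w (a - q) 0 c else 0 := fun a c => by
      simpa using h.monomial_smul_dual_monomial hw a c q 0 0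
    have h0 : ∀ c ∈ Finset.range n, mkS K (x K) ^ q •
        τ (mkS K (x K ^ (0 + 1) * z K ^ c) • e) ^ q • w (q * 0 + (q - 1)) 0 (q * c + (q - 1)) = 0 :=
      fun c _ => by rw [smul_scalar_comm, hx, if_neg (by omega), smul_zero]
    rw [Finset.sum_eq_zero h0, add_zero]
    refine Finset.sum_congr rfl fun a _ => ?_
    rw [Finset.smul_sum]
    refine Finset.sum_congr rfl fun c _ => ?_
    rw [smul_scalar_comm, hx, if_pos (by rw [mul_add]; omega), ← mul_smul, ← map_mul]
    congr 2
    · ring_nf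
    · rw [mul_add]; omega
  · rw [smul_comm, h1.1, smul_zero]
  · rw [smul_comm, h1.2, smul_zero]

theorem frobeniusFun_z_smul (h : IsSocleFunctional σ τ) {w : ℕ → ℕ → ℕ → E}
    (hw : ∀ a b c, ∀ r : R K, τ (mkS K r • w a b c) =
      if b = 0 ∨ (a = 0 ∧ c = 0) then coeffAt a b c r else 0) {q : ℕ} (hq : q ≠ 0) (e : E) :
    frobeniusFun τ w q (mkS K (z K) • e) = mkS K (z K) ^ q • frobeniusFun τ w q e := by
  obtain ⟨n, hn⟩ := h.exists_pow_smul_eq_zero e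
  have h1 := hn n le_rfl
  rw [frobeniusFun_eq_sum hq h1.1 (hn (n + 1) (by omega)).2,
    frobeniusFun_eq_sum hq (m := n) (n := n), Finset.smul_sum]
  · have hz : ∀ a c, mkS K (z K) ^ q • w a 0 c = if q ≤ c then w a 0 (c - q) else 0 := fun a c => by
      simpa using h.monomial_smul_dual_monomial hw a c 0 0 q
    refine Finset.sum_congr rfl fun a _ => ?_
    rw [Finset.sum_range_succ', smul_add, Finset.smul_sum, smul_scalar_comm _ _ (w _ _ _), hz,
      if_neg (by omega), smul_zero, add_zero]
    refine Finset.sum_congr rfl fun c _ => ?_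
    rw [smul_scalar_comm, hz, if_pos (by rw [mul_add]; omega), ← mul_smul, ← map_mul]
    congr 2
    · ring_nf
    · rw [mul_add]; omega
  · rw [smul_comm, h1.1, smul_zero]
  · rw [smul_comm, h1.2, smul_zero]

theorem frobeniusFun_y_smul (h : IsSocleFunctional σ τ) {w : ℕ → ℕ → ℕ → E}
    (hw : ∀ a b c, ∀ r : R K, τ (mkS K r • w a b c) =
      if b = 0 ∨ (a = 0 ∧ c = 0) then coeffAt a b c r else 0) {q : ℕ} (hq : q ≠ 0) (e : E) :
    frobeniusFun τ w q (mkS K (y K) • e) = mkS K (y K) ^ q • frobeniusFun τ w q e := by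
  obtain ⟨n, hn⟩ := h.exists_pow_smul_eq_zero e
  have h1 := hn n le_rfl
  have hy : ∀ a c, mkS K (y K) ^ q • w a 0 c = 0 := fun a c => by
    simpa [hq] using h.monomial_smul_dual_monomial hw a c 0 q 0
  have hxy : ∀ a c, mkS K (x K ^ (a + 1) * z K ^ c) • mkS K (y K) • e = 0 := fun a c => by
    have h0 : mkS K (x K ^ (a + 1) * y K ^ 1 * z K ^ c) = 0 :=
      Ideal.Quotient.eq_zero_iff_mem.mpr (monomial_mem_I (by omega))
    rw [← mul_smul, ← map_mul, mul_right_comm, ← pow_one (y K), h0]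
    exact zero_smul (S K) e
  rw [frobeniusFun_eq_sum hq h1.1 h1.2, frobeniusFun_eq_sum hq (m := n) (n := n), Finset.smul_sum]
  · refine Finset.sum_congr rfl fun a _ => ?_
    rw [Finset.smul_sum]
    refine Finset.sum_congr rfl fun c _ => ?_
    rw [smul_scalar_comm, hy, smul_zero, hxy, map_zero, zero_pow hq, zero_smul]
  · rw [smul_comm, h1.1, smul_zero]
  · rw [smul_comm, h1.2, smul_zero]

theorem frobeniusFun_scalar_smul (h : IsSocleFunctional σ τ) (w : ℕ → ℕ → ℕ → E) {q : ℕ}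
    (hq : q ≠ 0) (k : K) (e : E) :
    frobeniusFun τ w q (k • e) = k ^ q • frobeniusFun τ w q e := by
  obtain ⟨n, hn⟩ := h.exists_pow_smul_eq_zero e
  have h1 := hn n le_rfl
  rw [frobeniusFun_eq_sum hq h1.1 h1.2, frobeniusFun_eq_sum hq (m := n) (n := n), Finset.smul_sum]
  · refine Finset.sum_congr rfl fun a _ => ?_
    rw [Finset.smul_sum]
    refine Finset.sum_congr rfl fun c _ => ?_
    rw [smul_scalar_comm, τ.map_smul, smul_eq_mul, mul_pow, mul_smul]
  · rw [smul_scalar_comm, h1.1, smul_zero]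
  · rw [smul_scalar_comm, h1.2, smul_zero]

theorem frobeniusFun_smul (h : IsSocleFunctional σ τ) {w : ℕ → ℕ → ℕ → E}
    (hw : ∀ a b c, ∀ r : R K, τ (mkS K r • w a b c) =
      if b = 0 ∨ (a = 0 ∧ c = 0) then coeffAt a b c r else 0) (t : ℕ) (s : S K) (e : E) :
    frobeniusFun τ w (p ^ t) (s • e) = s ^ p ^ t • frobeniusFun τ w (p ^ t) e := by
  have hq : p ^ t ≠ 0 := pow_ne_zero _ hp.out.ne_zero
  -- The `r` for which semilinearity holds are closed under sums in characteristic `p`. They contain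
  -- the variables and are stable under scalars, hence contain all truncations.
  let T : Subsemiring (R K) :=
    { carrier := {r | ∀ e, frobeniusFun τ w (p ^ t) (mkS K r • e) =
        mkS K (r ^ p ^ t) • frobeniusFun τ w (p ^ t) e}
      zero_mem' := fun e => by
        have h0 := h.frobeniusFun_scalar_smul w hq 0 e
        rw [zero_smul, zero_pow hq, zero_smul] at h0
        rw [zero_pow hq, map_zero]
        exact (congrArg _ (zero_smul (S K) e)).trans (h0.trans
          (zero_smul (S K) (frobeniusFun τ w (p ^ t) e)).symm)
      one_mem' := fun e => by
        rw [one_pow, map_one]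
        exact (congrArg _ (one_smul (S K) e)).trans
          (one_smul (S K) (frobeniusFun τ w (p ^ t) e)).symm
      add_mem' := fun {a b} ha hb e => by
        rw [map_add, add_smul, h.frobeniusFun_add, ha, hb, add_pow_char_pow, map_add, add_smul]
      mul_mem' := fun {a b} ha hb e => by
        rw [map_mul, mul_smul, ha, hb, mul_pow, map_mul, mul_smul] }
  have hx : x K ∈ T := fun e => by rw [map_pow]; exact h.frobeniusFun_x_smul hw hq e
  have hy : y K ∈ T := fun e => by rw [map_pow]; exact h.frobeniusFun_y_smul hw hq e
  have hz : z K ∈ T := fun e => by rw [map_pow]; exact h.frobeniusFun_z_smul hw hq e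
  have hscalar : ∀ k : K, ∀ r ∈ T, k • r ∈ T := fun k r hr e => by
    rw [mkS_smul_smul, h.frobeniusFun_scalar_smul w hq, hr, smul_pow, mkS_smul_smul]
  have htrunc : ∀ (n : ℕ) (r : R K), boxTrunc n r ∈ T := fun n r =>
    sum_mem fun d _ => hscalar _ _ (mul_mem (mul_mem (pow_mem hx _) (pow_mem hy _)) (pow_mem hz _))
  obtain ⟨r, rfl⟩ := Ideal.Quotient.mk_surjective s
  obtain ⟨n, hn⟩ := h.torsion e
  obtain ⟨n', hn'⟩ := h.torsion (frobeniusFun τ w (p ^ t) e)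
  -- Both `e` and its image are torsion, so one truncation can replace `r` on the two sides; on the
  -- right, `r ^ q` minus the power of the truncation is the `q`-th power of the difference.
  have hmem := sub_boxTrunc_mem (max n n') r
  have h1 : mkS K r • e = mkS K (boxTrunc (max n n') r) • e :=
    mkS_smul_eq_boxTrunc (fun f hf => hn f (idealJ_antitone (le_max_left _ _) hf)) r
  have h2 : mkS K ((r - boxTrunc (max n n') r) ^ p ^ t) • frobeniusFun τ w (p ^ t) e = 0 :=
    hn' _ (idealJ_antitone (le_max_right _ _)
      (Ideal.pow_mem_of_mem _ hmem _ (Nat.pos_of_ne_zero hq)))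
  rw [sub_pow_char_pow, map_sub, sub_smul, sub_eq_zero] at h2
  rw [← map_pow, h1, h2]
  exact htrunc _ r e

end IsSocleFunctional

/-! ### The obstruction to finite generation. -/

section Generation

variable (p : ℕ) {K : Type u} [Field K] (E : Type u) [AddCommGroup E] [Module (S K) E]

/-- The additive endomorphisms `φ` of `E` such that `x ^ (q - 1) z ^ (q - 1) φ(u) = 0`, where
`q = p ^ t`, for all `u` with `z u = 0` and `x ^ 2 u = 0`. -/
def socleVanishing (t : ℕ) : AddSubgroup (AddMonoid.End E) where
  carrier := {φ | ∀ u : E, mkS K (z K) • u = 0 → mkS K (x K) • mkS K (x K) • u = 0 →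
    (mkS K (x K) ^ (p ^ t - 1) * mkS K (z K) ^ (p ^ t - 1)) • φ u = 0}
  zero_mem' := fun _ _ _ => smul_zero _
  add_mem' := fun {φ ψ} hφ hψ u h1 h2 => by
    change _ • (φ u + ψ u) = 0
    rw [smul_add, hφ u h1 h2, hψ u h1 h2, add_zero]
  neg_mem' := fun {φ} hφ u h1 h2 => by
    change _ • -(φ u) = 0
    rw [smul_neg, hφ u h1 h2, neg_zero]

variable {p E}

theorem mkS_x_mul_y : mkS K (x K) * mkS K (y K) = 0 := by
  rw [← map_mul]
  exact Ideal.Quotient.eq_zero_iff_mem.mpr (Ideal.subset_span (by simp))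

theorem mkS_y_mul_z : mkS K (y K) * mkS K (z K) = 0 := by
  rw [← map_mul]
  exact Ideal.Quotient.eq_zero_iff_mem.mpr (Ideal.subset_span (by simp))

theorem mul_mem_socleVanishing_left {j : ℕ} {φ ψ : AddMonoid.End E}
    (hφ : φ ∈ frobeniusMaps p (S K) E 0) (hψ : ψ ∈ socleVanishing (K := K) p E j) :
    φ * ψ ∈ socleVanishing (K := K) p E j := by
  intro u h1 h2
  have h3 := hφ (mkS K (x K) ^ (p ^ j - 1) * mkS K (z K) ^ (p ^ j - 1)) (ψ u)
  rw [hψ u h1 h2, map_zero, pow_zero, pow_one] at h3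
  exact h3.symm

theorem mul_mem_socleVanishing_right {i : ℕ} {φ ψ : AddMonoid.End E}
    (hφ : φ ∈ socleVanishing (K := K) p E i) (hψ : ψ ∈ frobeniusMaps p (S K) E 0) :
    φ * ψ ∈ socleVanishing (K := K) p E i := by
  have hlin : ∀ (s : S K) (m : E), ψ (s • m) = s • ψ m := fun s m => by
    simpa using hψ s m
  intro u h1 h2
  refine hφ (ψ u) ?_ ?_
  · rw [← hlin, h1, map_zero]
  · rw [← hlin, ← hlin, h2, map_zero]

/-- Both maps are controlled on socle elements. First `x u` lies in the socle, which makes `v = (x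
z) ^ (p ^ j - 1) • ψ u` a socle element; then `z ^ (p ^ i - 1)` kills `φ v`. -/
theorem mul_mem_socleVanishing [hp : Fact p.Prime]
    (hdiv : ∀ v : E, mkS K (x K) • v = 0 → mkS K (y K) • v = 0 → mkS K (z K) • v = 0 →
      ∃ v', mkS K (y K) • v' = v) {i j : ℕ} (hi : 1 ≤ i) (hj : 1 ≤ j) {φ ψ : AddMonoid.End E}
    (hφ : φ ∈ frobeniusMaps p (S K) E i) (hψ : ψ ∈ frobeniusMaps p (S K) E j) :
    φ * ψ ∈ socleVanishing (K := K) p E (i + j) := by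
  have hp2 : ∀ t, 1 ≤ t → 2 ≤ p ^ t := fun t ht =>
    hp.out.two_le.trans (Nat.le_self_pow (by omega) p)
  have hsocle : ∀ (t : ℕ), 1 ≤ t → ∀ χ ∈ frobeniusMaps p (S K) E t, ∀ v : E,
      mkS K (x K) • v = 0 → mkS K (y K) • v = 0 → mkS K (z K) • v = 0 →
      mkS K (z K) ^ (p ^ t - 1) • χ v = 0 := by
    intro t ht χ hχ v hx hy hz
    obtain ⟨v', rfl⟩ := hdiv v hx hy hz
    have h2 := hp2 t ht
    obtain ⟨k, hk⟩ : ∃ k, p ^ t = k + 2 := ⟨p ^ t - 2, by omega⟩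
    rw [hχ, hk, ← mul_smul, Nat.add_sub_assoc (by norm_num)]
    have h0 : mkS K (z K) ^ (k + (2 - 1)) * mkS K (y K) ^ (k + 2) = 0 := by
      have : mkS K (z K) ^ (k + (2 - 1)) * mkS K (y K) ^ (k + 2) =
        mkS K (y K) * mkS K (z K) * (mkS K (z K) ^ k * mkS K (y K) ^ (k + 1)) := by ring
      rw [this, mkS_y_mul_z, zero_mul]
    rw [h0]
    exact zero_smul (S K) (χ v')
  intro u hz hx
  set X := mkS K (x K) with hX
  set Y := mkS K (y K) with hY
  set Z := mkS K (z K) with hZ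
  obtain ⟨a, ha⟩ : ∃ a, p ^ i = a + 2 := ⟨p ^ i - 2, by have := hp2 i hi; omega⟩
  obtain ⟨b, hb⟩ : ∃ b, p ^ j = b + 2 := ⟨p ^ j - 2, by have := hp2 j hj; omega⟩
  -- This splitting lets `(x z) ^ ((b + 1) * p ^ i)` pass through `φ` as `(x z) ^ (b + 1)`.
  have hexp : p ^ (i + j) - 1 = (a + 1) + (b + 1) * p ^ i := by
    rw [pow_add, ha, hb, Nat.sub_eq_iff_eq_add (by nlinarith)]
    ring
  have hvx : Z ^ (b + 1) • ψ (X • u) = 0 := by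
    have := hsocle j hj ψ hψ (X • u) hx
      (by rw [← mul_smul, mul_comm, mkS_x_mul_y]; exact zero_smul (S K) u)
      (by rw [smul_comm, hz, smul_zero])
    rwa [hb] at this
  have hψx : X ^ (b + 2) • ψ u = ψ (X • u) := by rw [hψ, hb]
  have hψz : Z ^ (b + 2) • ψ u = 0 := by
    have := hψ Z u
    rw [hz, map_zero, hb] at this
    exact this.symm
  have hw := hsocle i hi φ hφ ((X ^ (b + 1) * Z ^ (b + 1)) • ψ u)
    (by
      have : X * (X ^ (b + 1) * Z ^ (b + 1)) = Z ^ (b + 1) * X ^ (b + 2) := by ring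
      rw [← mul_smul, this, mul_smul, hψx, hvx])
    (by
      have : Y * (X ^ (b + 1) * Z ^ (b + 1)) = X * Y * (X ^ b * Z ^ (b + 1)) := by ring
      rw [← mul_smul, this, mkS_x_mul_y, zero_mul]
      exact zero_smul (S K) (ψ u))
    (by
      have : Z * (X ^ (b + 1) * Z ^ (b + 1)) = X ^ (b + 1) * Z ^ (b + 2) := by ring
      rw [← mul_smul, this, mul_smul, hψz, smul_zero])
  rw [hφ, ha] at hw
  have hring : X ^ ((a + 1) + (b + 1) * p ^ i) * Z ^ ((a + 1) + (b + 1) * p ^ i) =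
      X ^ (a + 1) * (Z ^ (a + 1) * (X ^ (b + 1) * Z ^ (b + 1)) ^ (a + 2)) := by
    rw [ha]; ring
  rw [hexp, hring, mul_smul, mul_smul]
  change _ • _ • _ • φ (ψ u) = 0
  rw [show a + 2 - 1 = a + 1 from rfl] at hw
  rw [hw, smul_zero]

/-- If in every positive degree some Frobenius map is not in `socleVanishing`, then the algebra of
Frobenius maps is not finitely generated. -/
theorem not_finitelyGeneratedOver_ofEnd [hp : Fact p.Prime]
    (hdiv : ∀ v : E, mkS K (x K) • v = 0 → mkS K (y K) • v = 0 → mkS K (z K) • v = 0 →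
      ∃ v', mkS K (y K) • v' = v)
    (hex : ∀ t, ∃ φ ∈ frobeniusMaps p (S K) E t, φ ∉ socleVanishing (K := K) p E t) :
    ¬ FinitelyGeneratedOver (ofEnd p (S K) E) := by
  classical
  rintro ⟨T, hT⟩
  let N := T.sup fun f => f.support.sup id
  -- `N` bounds the degrees occurring in `T`, so `A` contains `T` and all of degree `0`. In a
  -- product of degree above `N`, a term with a factor of degree `0` has its other factor in degree
  -- above `N`; the remaining terms are composites of positive degrees.
  let A : Subring (FrobeniusAlgebra p (S K) E) :=
    { carrier := {f | ∀ t, N < t → ((f t : frobeniusMaps p (S K) E t) : AddMonoid.End E) ∈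
        socleVanishing (K := K) p E t}
      zero_mem' := fun t _ => zero_mem (socleVanishing (K := K) p E t)
      one_mem' := fun t ht => by
        have : (1 : FrobeniusAlgebra p (S K) E) t = 0 :=
          DirectSum.of_eq_of_ne (β := fun e => frobeniusMaps p (S K) E e) 0 t _ (by omega)
        rw [this]
        exact zero_mem (socleVanishing (K := K) p E t)
      add_mem' := fun {f g} hf hg t ht => add_mem (hf t ht) (hg t ht)
      neg_mem' := fun {f} hf t ht => neg_mem (hf t ht)
      mul_mem' := fun {f g} hf hg t ht => by
        rw [DirectSum.coe_mul_apply]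
        refine sum_mem fun ⟨i, j⟩ hij => ?_
        obtain rfl : i + j = t := (Finset.mem_filter.mp hij).2
        rcases Nat.eq_zero_or_pos i with rfl | hi
        · rw [zero_add] at ht ⊢
          exact mul_mem_socleVanishing_left (f 0).2 (hg j ht)
        rcases Nat.eq_zero_or_pos j with rfl | hj
        · exact mul_mem_socleVanishing_right (hf i ht) (g 0).2
        · exact mul_mem_socleVanishing hdiv hi hj (f i).2 (g j).2 }
  have hA : A = ⊤ := by
    rw [eq_top_iff, ← hT, Subring.closure_le]
    rintro f (⟨θ, rfl⟩ | hf)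
    · intro t ht
      have : ofEnd p (S K) E θ t = 0 :=
        DirectSum.of_eq_of_ne (β := fun e => frobeniusMaps p (S K) E e) 0 t _ (by omega)
      rw [this]
      exact zero_mem (socleVanishing (K := K) p E t)
    · intro t ht
      have h0 : f t = 0 := by
        by_contra hne
        have h1 : t ≤ f.support.sup id := Finset.le_sup (f := id) (DFinsupp.mem_support_iff.mpr hne)
        have h2 : f.support.sup id ≤ N := Finset.le_sup (f := fun f => f.support.sup id) hf
        omega
      rw [h0]
      exact zero_mem (socleVanishing (K := K) p E t)
  obtain ⟨φ, hφ, hφ'⟩ := hex (N + 1)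
  have hmem : DirectSum.of (fun e => frobeniusMaps p (S K) E e) (N + 1) ⟨φ, hφ⟩ ∈ A :=
    hA ▸ Subring.mem_top _
  have := hmem (N + 1) (Nat.lt_succ_self N)
  rw [DirectSum.of_eq_same] at this
  exact hφ' this

end Generation

/-! ### The socle is divisible by `y`, and `frobeniusFun` escapes the obstruction. -/

namespace IsSocleFunctional

variable {K : Type u} [Field K] {E : Type u} [AddCommGroup E] [Module (S K) E] [Module K E]
  [IsScalarTower K (S K) E] {σ : E} {τ : E →ₗ[K] K}

/-- If `e` is dual to `y`, then `y e` is dual to `1`, and a socle element `v` pairs nontrivially at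
most with the monomial `1`, so `v = τ v • y e`. -/
theorem exists_y_smul_eq (h : IsSocleFunctional σ τ) {v : E} (hx : mkS K (x K) • v = 0)
    (hy : mkS K (y K) • v = 0) (hz : mkS K (z K) • v = 0) : ∃ v', mkS K (y K) • v' = v := by
  obtain ⟨e, he⟩ := h.exists_dual_monomial 0 1 0 (by simp)
  refine ⟨τ v • e, h.ext_monomial fun a b c => ?_⟩
  rw [smul_scalar_comm, smul_scalar_comm, τ.map_smul, ← mul_smul, ← map_mul, he,
    show x K ^ a * y K ^ b * z K ^ c * y K = x K ^ a * y K ^ (b + 1) * z K ^ c by ring,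
    coeffAt_monomial, map_mul, map_mul, map_pow, map_pow, map_pow]
  rcases Nat.eq_zero_or_pos c with rfl | hc
  · rcases Nat.eq_zero_or_pos b with rfl | hb
    · rcases Nat.eq_zero_or_pos a with rfl | ha
      · simp
      · obtain ⟨a, rfl⟩ := Nat.exists_eq_succ_of_ne_zero ha.ne'
        rw [pow_zero, pow_zero, mul_one, mul_one, pow_succ, mul_smul, hx]
        simp
    · obtain ⟨b, rfl⟩ := Nat.exists_eq_succ_of_ne_zero hb.ne'
      rw [pow_zero, mul_one, pow_succ, mul_smul, mul_smul, hy]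
      simp
  · obtain ⟨c, rfl⟩ := Nat.exists_eq_succ_of_ne_zero hc.ne'
    rw [pow_succ, mul_smul, mul_smul, mul_smul, hz]
    simp

theorem exists_frobeniusMap_notMem_socleVanishing {p : ℕ} [hp : Fact p.Prime] [CharP K p]
    (h : IsSocleFunctional σ τ) (t : ℕ) :
    ∃ φ ∈ frobeniusMaps p (S K) E t, φ ∉ socleVanishing (K := K) p E t := by
  have hq : p ^ t ≠ 0 := pow_ne_zero _ hp.out.ne_zero
  obtain ⟨w, hw⟩ := h.exists_dual_monomials
  refine ⟨AddMonoidHom.mk' (frobeniusFun τ w (p ^ t)) (h.frobeniusFun_add w t),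
    h.frobeniusFun_smul hw t, fun hmem => ?_⟩
  have hx : mkS K (x K) • w 1 0 0 = w 0 0 0 := by
    simpa using h.monomial_smul_dual_monomial hw 1 0 1 0 0
  have hxx : mkS K (x K) • w 0 0 0 = 0 := by
    simpa using h.monomial_smul_dual_monomial hw 0 0 1 0 0
  have hz : mkS K (z K) • w 1 0 0 = 0 := by
    simpa using h.monomial_smul_dual_monomial hw 1 0 0 0 1
  have hφ : frobeniusFun τ w (p ^ t) (w 1 0 0) = w (p ^ t - 1) 0 (p ^ t - 1) := by
    rw [frobeniusFun_eq_sum hq (m := 2) (n := 1)]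
    · rw [Finset.sum_range_succ, Finset.sum_range_one, Finset.sum_range_one, Finset.sum_range_one]
      have h0 := coeffAt_monomial (K := K) 1 0 0 1 0 0
      have h1 := coeffAt_monomial (K := K) 1 0 0 2 0 0
      simp only [pow_zero, mul_one, pow_one] at h0 h1
      simp [-map_pow, -map_mul, hw, h0, h1, hp.out.ne_zero]
    · rw [pow_two, mul_smul, hx, hxx]
    · rw [pow_one, hz]
  have h1 := hmem (w 1 0 0) hz (by rw [hx, hxx])
  change _ • frobeniusFun τ w (p ^ t) (w 1 0 0) = 0 at h1
  have h2 := h.monomial_smul_dual_monomial hw (p ^ t - 1) (p ^ t - 1) (p ^ t - 1) 0 (p ^ t - 1)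
  rw [pow_zero, mul_one, map_mul, map_pow, map_pow, ← hφ, h1, if_pos ⟨le_rfl, rfl, le_rfl⟩,
    Nat.sub_self] at h2
  have h3 := hw 0 0 0 1
  rw [← h2, smul_zero, map_zero, if_pos (Or.inl rfl)] at h3
  have h4 := coeffAt_monomial (K := K) 0 0 0 0 0 0
  simp only [pow_zero, mul_one, and_self, if_true] at h4
  exact zero_ne_one (h3.trans h4)

end IsSocleFunctional

end FrobeniusMaps

open FrobeniusMaps in
theorem mainTheorem1 {p : ℕ} [Fact p.Prime] {K : Type u} [Field K] [CharP K p]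
    {E : Type u} [AddCommGroup E] [Module (S K) E]
    (i : IsLocalRing.ResidueField (S K) →ₗ[S K] E) (hE : IsInjectiveHull i) :
    -- `S → Hom_S(E, E)` is an isomorphism
    Function.Bijective (algebraMap (S K) (Module.End (S K) E)) ∧
    -- `𝓕(E)` is not finitely generated over `Hom_S(E, E)`
    ¬ FinitelyGeneratedOver (ofEnd p (S K) E) ∧
    -- `x ^ (p ^ e) * y ^ (p ^ e - 1)` is one of the generators of `K_e` and is not in `L_e`
    ∀ e : ℕ, 1 ≤ e →
      idealK p (I K) e = Ideal.span
        {x K ^ (p ^ e) * y K ^ (p ^ e - 1),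
          x K ^ (p ^ e - 1) * y K ^ (p ^ e - 1) * z K ^ (p ^ e - 1),
          y K ^ (p ^ e - 1) * z K ^ (p ^ e)} ∧
      x K ^ (p ^ e) * y K ^ (p ^ e - 1) ∉ idealL p (I K) e := by
  -- The functional `τ` requires a `K`-structure on `E`, obtained by restricting scalars along `K →
  -- S`.
  let _ : Module K E := Module.compHom E (algebraMap K (S K))
  have : IsScalarTower K (S K) E := ⟨fun a s e =>
    (congrArg (· • e) (Algebra.smul_def a s)).trans (mul_smul (algebraMap K (S K) a) s e)⟩
  obtain ⟨σ, τ, h⟩ := exists_isSocleFunctional (K := K) i hE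
  exact ⟨h.bijective_algebraMap_end,
    not_finitelyGeneratedOver_ofEnd (fun _ hx hy hz => h.exists_y_smul_eq hx hy hz)
      fun t => h.exists_frobeniusMap_notMem_socleVanishing t,
    fun e he => ⟨idealK_eq_span, monomial_notMem_idealL he⟩⟩
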